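/- Let $G=(V,E)$ be a connected simple undirected graph, possibly infinite (and not necessarily locally finite), with graph distance $d$, and write $B_r(v)=\{x\in V: d(v,x)\le r\}$. Let $s,s'$ be integers with $0<s'<s$. Suppose that $G$ is $(s,s')^*$-dismantlable, i.e. that $V$ admits a well-order $\preceq$ such that for every vertex $v$ other than the least one there is a vertex $u\ne v$ with $u\preceq v$ and $$B_s(v)\cap\{w\in V: w\preceq v\}\subseteq B_{s'}(u).$$ Then $G$ is $\delta$-hyperbolic with $$\delta = 16(s+s')\left\lceil \frac{s+s'}{s-s'}\right\rceil+\frac12\;\le\; 32\,\frac{s(s+s')}{s-s'}+\frac12,$$ that is, for any four vertices of $G$, say $u,v,x,y$, the two larger of the three sums $d(u,v)+d(x,y)$, $d(u,x)+d(v,y)$, $d(u,y)+d(v,x)$ differ by at most $2\delta$. -/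

import Mathlib

/-- The ball `B_r(v, G)`: the vertices at graph distance at most `r` from `v`. The extended
distance is used so that vertices not reachable from `v` never belong to the ball. -/
def graphBall {V : Type*} (G : SimpleGraph V) (r : ℕ) (v : V) : Set V :=
  {x | G.edist v x ≤ (r : ℕ∞)}

/-- `G` is `(s, s')^*`-dismantlable: the vertex set has a (strict) well-order `lt` such that every
vertex `v` other than the least one has a strictly smaller vertex `u` with
`B_s(v, G) ∩ X_v ⊆ B_{s'}(u, G)`, where `X_v` is the set of vertices `w` with `w = v` or
`w` smaller than `v`. -/
def IsStarDismantlable {V : Type*} (G : SimpleGraph V) (s s' : ℕ) : Prop :=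
  ∃ lt : V → V → Prop, IsWellOrder V lt ∧
    ∀ v : V, (∃ w : V, lt w v) →
      ∃ u : V, lt u v ∧
        graphBall G s v ∩ {w | lt w v ∨ w = v} ⊆ graphBall G s' u

/-- A connected graph `G` is `δ`-hyperbolic: for any four vertices, the two larger of the three
distance sums differ by at most `2 * δ`. The four vertices are labelled so that the sums appear in
decreasing order; since all labellings are quantified over, this covers all cases. -/
def IsHyperbolicGraph {V : Type*} (G : SimpleGraph V) (δ : ℝ) : Prop :=
  ∀ u v x y : V,
    G.dist u y + G.dist v x ≤ G.dist u x + G.dist v y →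
    G.dist u x + G.dist v y ≤ G.dist u v + G.dist x y →
    ((G.dist u v : ℝ) + G.dist x y) - ((G.dist u x : ℝ) + G.dist v y) ≤ 2 * δ

/-! Dismantlability gives a linear isoperimetric inequality, and that gives hyperbolicity. The area
of a closed walk is `∫ f dg` with `f`, `g` edge-Lipschitz, so no fillings are needed. At the largest
vertex of a long closed walk, the arc of length `2s` around it is replaced by one of length at most
`2s'` through the dominating vertex `u`. The area changes by at most `(s+s')²`, so induction on
length bounds it by `κ` times the length, `κ = (s+s')²/(2(s-s'))`
(`hasLinearArea_of_isStarDismantlable`). Conversely, suppose defects are at most `D` up to some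
perimeter and a quadrilateral attains `D`. Let `e ≥ D` be its largest sum minus its smallest.
Cutting off the corners leaves a loop of length at most `e+13D+4` and area at least `eD/4`
(`FourPointBound.area_le`), impossible if `D > 64κ`. So the trivial bound, the perimeter, descends
to `64κ` (`HasLinearArea.le_add`). -/

namespace SimpleGraph

/-! ### Discrete line integrals along walks. -/

variable {V : Type*} {G : SimpleGraph V}

/-- A real function on the vertices that changes by at most `1` along every edge. -/
def IsEdgeLipschitz (G : SimpleGraph V) (f : V → ℝ) : Prop :=
  ∀ x y, G.Adj x y → |f x - f y| ≤ 1

/-- The trapezoidal sum approximating `∫ f dg` along a walk. -/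
noncomputable def Walk.integral (f g : V → ℝ) : ∀ {u v : V}, G.Walk u v → ℝ
  | _, _, .nil => 0
  | u, _, .cons (v := w) _ p => (f u + f w) / 2 * (g w - g u) + p.integral f g

namespace Walk

variable {f g : V → ℝ} {u v w : V}

@[simp]
theorem integral_nil : (nil : G.Walk u u).integral f g = 0 := rfl

@[simp]
theorem integral_cons (h : G.Adj u w) (p : G.Walk w v) :
    (cons h p).integral f g = (f u + f w) / 2 * (g w - g u) + p.integral f g := rfl

theorem integral_append (p : G.Walk u v) (q : G.Walk v w) :
    (p.append q).integral f g = p.integral f g + q.integral f g := by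
  induction p with
  | nil => simp
  | cons h p ih => simp [ih]; ring

theorem integral_reverse (p : G.Walk u v) : p.reverse.integral f g = -p.integral f g := by
  induction p with
  | nil => simp
  | cons h p ih => simp [integral_append, ih]; ring

theorem abs_sub_le_length (hf : G.IsEdgeLipschitz f) (p : G.Walk u v) :
    |f u - f v| ≤ p.length := by
  induction p with
  | nil => simp
  | @cons a b c h p ih =>
    have h1 := hf _ _ h
    push_cast [length_cons]
    calc |f a - f c| ≤ |f a - f b| + |f b - f c| := abs_sub_le _ _ _
      _ ≤ _ := by linarith

theorem abs_integral_sub_le (hg : G.IsEdgeLipschitz g) {c r : ℝ} (p : G.Walk u v)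
    (hr : ∀ z ∈ p.support, |f z - c| ≤ r) :
    |p.integral f g - c * (g v - g u)| ≤ r * p.length := by
  induction p with
  | nil => simp
  | @cons a b d h p ih =>
    have ha := hr a (by simp)
    have hb := hr b (by simp)
    have ih' := ih fun z hz => hr z (by simp [hz])
    have h1 := hg _ _ h
    rw [abs_sub_comm] at h1
    have h2 : |(f a + f b) / 2 - c| ≤ r := by
      rw [abs_le] at *
      constructor <;> linarith
    have h3 : |((f a + f b) / 2 - c) * (g b - g a)| ≤ r * 1 := by
      rw [abs_mul]
      exact mul_le_mul h2 h1 (abs_nonneg _) ((abs_nonneg _).trans h2)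
    push_cast [length_cons, integral_cons]
    calc |(f a + f b) / 2 * (g b - g a) + p.integral f g - c * (g d - g a)|
        = |((f a + f b) / 2 - c) * (g b - g a) + (p.integral f g - c * (g d - g b))| := by
          congr 1; ring
      _ ≤ _ := (abs_add_le _ _).trans (by linarith)

theorem integral_eq_of_left_const {c : ℝ} (p : G.Walk u v) (h : ∀ z ∈ p.support, f z = c) :
    p.integral f g = c * (g v - g u) := by
  induction p with
  | nil => simp
  | @cons a b d hab p ih =>
    rw [integral_cons, ih fun z hz => h z (by simp [hz]), h a (by simp), h b (by simp)]
    ring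

theorem integral_eq_zero_of_right_const {c : ℝ} (p : G.Walk u v)
    (h : ∀ z ∈ p.support, g z = c) : p.integral f g = 0 := by
  induction p with
  | nil => simp
  | @cons a b d hab p ih =>
    rw [integral_cons, ih fun z hz => h z (by simp [hz]), h a (by simp), h b (by simp)]
    ring

/-- On step `i`, counted from `0`, the mean of `f` differs from `f u` by at most `i + 1/2`; these
errors sum to `n²/2`. -/
theorem abs_integral_sub_start_le (hf : G.IsEdgeLipschitz f) (hg : G.IsEdgeLipschitz g)
    (p : G.Walk u v) :
    |p.integral f g - f u * (g v - g u)| ≤ (p.length : ℝ) ^ 2 / 2 := by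
  induction p with
  | nil => simp
  | @cons a b d h p ih =>
    have h1 := hf _ _ h
    have h2 := hg _ _ h
    have h3 := p.abs_sub_le_length hg
    rw [abs_sub_comm] at h1 h2 h3
    have h4 : |(f b - f a) * (g b - g a)| ≤ 1 * 1 := by
      rw [abs_mul]; exact mul_le_mul h1 h2 (abs_nonneg _) zero_le_one
    have h5 : |(f b - f a) * (g d - g b)| ≤ 1 * p.length := by
      rw [abs_mul]; exact mul_le_mul h1 h3 (abs_nonneg _) zero_le_one
    push_cast [length_cons, integral_cons]
    rw [show (f a + f b) / 2 * (g b - g a) + p.integral f g - f a * (g d - g a) =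
      (f b - f a) * (g b - g a) / 2 + (p.integral f g - f b * (g d - g b)) +
        (f b - f a) * (g d - g b) by ring]
    rw [abs_le] at *
    constructor <;> linarith

theorem abs_integral_sub_end_le (hf : G.IsEdgeLipschitz f) (hg : G.IsEdgeLipschitz g)
    (p : G.Walk u v) :
    |p.integral f g - f v * (g v - g u)| ≤ (p.length : ℝ) ^ 2 / 2 := by
  have h := abs_integral_sub_start_le hf hg p.reverse
  rw [integral_reverse, length_reverse] at h
  rw [abs_sub_comm]
  convert h using 2
  ring

theorem exists_append_eq_of_le_length (p : G.Walk u v) {n : ℕ} (hn : n ≤ p.length) :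
    ∃ (w : V) (a : G.Walk u w) (b : G.Walk w v), a.length = n ∧ a.append b = p :=
  ⟨_, p.take n, p.drop n, by simp [take_length, hn], p.append_take_drop_eq n⟩

theorem exists_max_mem_support (lt : V → V → Prop) [IsWellOrder V lt] (p : G.Walk u v) :
    ∃ m ∈ p.support, ∀ z ∈ p.support, lt z m ∨ z = m := by
  induction p with
  | @nil a => exact ⟨a, by simp, by simp⟩
  | @cons a b c h p ih =>
    obtain ⟨m, hm, hmax⟩ := ih
    rcases trichotomous_of lt a m with hlt | rfl | hlt
    · refine ⟨m, by simp [hm], fun z hz => ?_⟩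
      rcases List.mem_cons.1 (support_cons h p ▸ hz) with rfl | hz
      exacts [.inl hlt, hmax z hz]
    · refine ⟨a, by simp, fun z hz => ?_⟩
      rcases List.mem_cons.1 (support_cons h p ▸ hz) with rfl | hz
      exacts [.inr rfl, hmax z hz]
    · refine ⟨a, by simp, fun z hz => ?_⟩
      rcases List.mem_cons.1 (support_cons h p ▸ hz) with rfl | hz
      · exact .inr rfl
      · rcases hmax z hz with hz | rfl
        exacts [.inl (_root_.trans hz hlt), .inl hlt]

theorem exists_closed_walk_from (c : G.Walk u u) (hv : v ∈ c.support) (f g : V → ℝ) :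
    ∃ c' : G.Walk v v, c'.length = c.length ∧ (∀ z ∈ c'.support, z ∈ c.support) ∧
      c'.integral f g = c.integral f g := by
  classical
  refine ⟨c.rotate v hv, length_rotate _ _ _, fun z hz => ?_, ?_⟩
  · exact (mem_support_rotate_iff c v hv).1 hz
  · conv_rhs => rw [← take_spec c hv, integral_append]
    rw [rotate, integral_append, add_comm]

end Walk

/-! ### The isoperimetric inequality from dismantlability. -/

theorem Connected.abs_sub_le_dist (hG : G.Connected) {f : V → ℝ} (hf : G.IsEdgeLipschitz f)
    (x y : V) : |f x - f y| ≤ G.dist x y := by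
  obtain ⟨p, hp⟩ := hG.exists_walk_length_eq_dist x y
  exact hp ▸ p.abs_sub_le_length hf

theorem Connected.mem_graphBall_iff (hG : G.Connected) {r : ℕ} {v x : V} :
    x ∈ graphBall G r v ↔ G.dist v x ≤ r := by
  rw [graphBall, Set.mem_ofPred_eq, ← (hG v x).coe_dist_eq_edist, Nat.cast_le]

theorem Walk.two_mul_dist_le_length {v z : V} (c : G.Walk v v)
    (hz : z ∈ c.support) : 2 * G.dist v z ≤ c.length := by
  classical
  have h1 := dist_le (c.takeUntil z hz)
  have h2 := dist_le (c.dropUntil z hz)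
  rw [G.dist_comm] at h2
  have h3 := congrArg length (c.take_spec hz)
  rw [length_append] at h3
  omega

/-- Replacing the middle `v` of a path from `p` to `q` by a vertex `u` near all of `p`, `v`, `q`
changes the trapezoidal sum by at most the square of the length of the loop divided by four. -/
theorem Walk.abs_integral_detour_le (hG : G.Connected) {f g : V → ℝ} (hf : G.IsEdgeLipschitz f)
    (hg : G.IsEdgeLipschitz g) {s s' : ℕ} (hs : s' ≤ s) {p q u v : V} (a : G.Walk p v)
    (b : G.Walk v q) (a' : G.Walk p u) (b' : G.Walk u q) (ha : a.length = s) (hb : b.length = s)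
    (ha' : a'.length ≤ s') (hb' : b'.length ≤ s') (huv : G.dist u v ≤ s') :
    |a.integral f g + b.integral f g - (a'.integral f g + b'.integral f g)| ≤
      ((s : ℝ) + s') ^ 2 := by
  have h1 := a.abs_integral_sub_end_le hf hg
  have h2 := b.abs_integral_sub_start_le hf hg
  have h3 := a'.abs_integral_sub_end_le hf hg
  have h4 := b'.abs_integral_sub_start_le hf hg
  have hs'' : (s' : ℝ) ≤ s := by exact_mod_cast hs
  have h0 : (0 : ℝ) ≤ s' := by positivity
  rw [ha] at h1
  rw [hb] at h2
  have h3' : (a'.length : ℝ) ^ 2 ≤ (s' : ℝ) ^ 2 := by gcongr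
  have h4' : (b'.length : ℝ) ^ 2 ≤ (s' : ℝ) ^ 2 := by gcongr
  have h5 : |f v - f u| ≤ s' := by
    rw [abs_sub_comm]
    exact (hG.abs_sub_le_dist hf u v).trans (by exact_mod_cast huv)
  have h6 : |g q - g p| ≤ 2 * s' := by
    have h := (a'.append b').abs_sub_le_length hg
    rw [abs_sub_comm, length_append] at h
    refine h.trans ?_
    have : a'.length + b'.length ≤ 2 * s' := by omega
    exact_mod_cast this
  have h7 : |(f v - f u) * (g q - g p)| ≤ s' * (2 * s') := by
    rw [abs_mul]; exact mul_le_mul h5 h6 (abs_nonneg _) h0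
  have h8 : (s' : ℝ) * s' ≤ s * s' := mul_le_mul_of_nonneg_right hs'' h0
  rw [abs_le] at h1 h2 h3 h4 h7 ⊢
  constructor <;> nlinarith

/-- Every closed walk satisfies a linear isoperimetric inequality, the enclosed area being measured
by the trapezoidal sums of edge-Lipschitz functions. -/
def HasLinearArea (G : SimpleGraph V) (κ : ℝ) : Prop :=
  ∀ f g : V → ℝ, G.IsEdgeLipschitz f → G.IsEdgeLipschitz g →
    ∀ (v : V) (c : G.Walk v v), |c.integral f g| ≤ κ * c.length

theorem hasLinearArea_of_isStarDismantlable (hG : G.Connected) {s s' : ℕ} (hss' : s' < s)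
    (hdis : IsStarDismantlable G s s') :
    G.HasLinearArea (((s : ℝ) + s') ^ 2 / (2 * ((s : ℝ) - s'))) := by
  obtain ⟨lt, hlt, hdis⟩ := hdis
  intro f g hf hg v c
  set κ : ℝ := ((s : ℝ) + s') ^ 2 / (2 * ((s : ℝ) - s')) with hκ
  have hsR : (0 : ℝ) < (s : ℝ) - s' := by
    rw [sub_pos]; exact_mod_cast hss'
  have hs'0 : (0 : ℝ) ≤ s' := by positivity
  have hκmul : κ * (2 * ((s : ℝ) - s')) = ((s : ℝ) + s') ^ 2 := by
    rw [hκ]; field_simp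
  have hκ0 : 0 ≤ κ := by positivity
  have hκs' : (s' : ℝ) ≤ κ := by
    rw [hκ, le_div_iff₀ (by positivity)]
    nlinarith [sq_nonneg ((s : ℝ) - s'), sq_nonneg (s' : ℝ)]
  induction hn : c.length using Nat.strong_induction_on generalizing v c with
  | _ n ih =>
    obtain ⟨m, hm, hmax⟩ := c.exists_max_mem_support lt
    obtain ⟨c, hlen, hsupp, hint⟩ := c.exists_closed_walk_from hm f g
    rw [← hint]
    replace hmax : ∀ z ∈ c.support, lt z m ∨ z = m := fun z hz => hmax z (hsupp z hz)
    replace hn : c.length = n := hlen.trans hn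
    clear hint hlen hsupp hm
    by_cases hleast : ∃ w, lt w m
    · obtain ⟨u, -, hu⟩ := hdis m hleast
      have hball : ∀ z, G.dist m z ≤ s → z ∈ c.support → G.dist u z ≤ s' := fun z hz hzc =>
        hG.mem_graphBall_iff.1 (hu ⟨hG.mem_graphBall_iff.2 hz, hmax z hzc⟩)
      -- A short walk lies entirely in the `s`-ball of `m`, hence in the `s'`-ball of `u`, where `f`
      -- is within `s'` of `f u`.
      by_cases hns : n ≤ 2 * s
      · have h := c.abs_integral_sub_le (f := f) (c := f u) (r := s') hg fun z hz => by
          rw [abs_sub_comm]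
          refine (hG.abs_sub_le_dist hf u z).trans ?_
          have := c.two_mul_dist_le_length hz
          exact_mod_cast hball z (by omega) hz
        rw [sub_self, mul_zero, sub_zero, hn] at h
        exact h.trans (by gcongr)
      -- The walk splits as `b`, `c₂`, `a` with `a` and `b` the arcs of length `s` on either side of
      -- `m`.
      · obtain ⟨q, b, c₁, hb, rfl⟩ := c.exists_append_eq_of_le_length (n := s) (by omega)
        rw [Walk.length_append] at hn
        obtain ⟨p, c₂, a, hc₂, rfl⟩ :=
          c₁.exists_append_eq_of_le_length (n := n - 2 * s) (by omega)
        rw [Walk.length_append] at hn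
        have ha : a.length = s := by omega
        obtain ⟨a', ha'⟩ := hG.exists_walk_length_eq_dist p u
        obtain ⟨b', hb'⟩ := hG.exists_walk_length_eq_dist u q
        have hp : G.dist u p ≤ s' := by
          refine hball p ?_ (by simp [Walk.mem_support_append_iff])
          rw [G.dist_comm, ← ha]; exact dist_le a
        have hq : G.dist u q ≤ s' :=
          hball q (hb ▸ dist_le b) (by simp [Walk.mem_support_append_iff])
        have hm' : G.dist u m ≤ s' := hball m (by simp) (by simp)
        rw [G.dist_comm] at ha'
        have hdet := Walk.abs_integral_detour_le hG hf hg hss'.le a b a' b' ha hb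
          (by omega) (by omega) hm'
        have hlen : (c₂.append (a'.append b')).length ≤ n - 2 * s + 2 * s' := by
          simp only [Walk.length_append]; omega
        have hih := ih _ (by omega) q (c₂.append (a'.append b')) rfl
        have hlenR : ((c₂.append (a'.append b')).length : ℝ) ≤ n - 2 * s + 2 * s' := by
          have : (c₂.append (a'.append b')).length + 2 * s ≤ n + 2 * s' := by omega
          have : ((c₂.append (a'.append b')).length : ℝ) + 2 * s ≤ n + 2 * s' := by
            exact_mod_cast this
          linarith
        have hih' := hih.trans (mul_le_mul_of_nonneg_left hlenR hκ0)
        simp only [Walk.integral_append] at hih' ⊢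
        -- The detour costs at most `κ` times the `2(s-s')` steps it saves.
        rw [← hκmul] at hdet
        rw [abs_le] at *
        constructor <;> linarith
    · have hconst : ∀ z ∈ c.support, g z = g m := fun z hz => by
        rcases hmax z hz with h | rfl
        exacts [(hleast ⟨z, h⟩).elim, rfl]
      rw [c.integral_eq_zero_of_right_const hconst, abs_zero]
      positivity

/-! ### Four-point defects and the corners of geodesic triangles. -/

/-- The four-point inequality with defect `D` for all quadrilaterals `u, x, v, y` whose perimeter is
at most `P`. -/
def FourPointBound (G : SimpleGraph V) (P D : ℕ) : Prop :=
  ∀ u v x y : V, G.dist u x + G.dist x v + G.dist v y + G.dist y u ≤ P →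
    G.dist u v + G.dist x y ≤ max (G.dist u x + G.dist v y) (G.dist u y + G.dist x v) + D

/-- Capping the perimeter provides a finite defect from which the descent can start. -/
theorem Connected.fourPointBound_self (hG : G.Connected) (P : ℕ) : G.FourPointBound P P := by
  intro u v x y h
  have h1 := hG.dist_triangle (u := u) (v := x) (w := v)
  have h2 := hG.dist_triangle (u := u) (v := y) (w := v)
  have h3 := hG.dist_triangle (u := x) (v := v) (w := y)
  have h4 := hG.dist_triangle (u := x) (v := u) (w := y)
  have := G.dist_comm (u := u) (v := y)
  have := G.dist_comm (u := u) (v := x)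
  have := G.dist_comm (u := v) (v := y)
  omega

theorem Connected.exists_geodesic (hG : G.Connected) (a b : V) :
    ∃ p : G.Walk a b, p.length = G.dist a b ∧
      ∀ z ∈ p.support, G.dist a z + G.dist z b = G.dist a b := by
  classical
  obtain ⟨p, hp⟩ := hG.exists_walk_length_eq_dist a b
  refine ⟨p, hp, fun z hz => ?_⟩
  have h1 := dist_le (p.takeUntil z hz)
  have h2 := dist_le (p.dropUntil z hz)
  have h3 := congrArg Walk.length (p.take_spec hz)
  rw [Walk.length_append] at h3
  have h4 := hG.dist_triangle (u := a) (v := z) (w := b)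
  omega

theorem Connected.exists_dist_eq (hG : G.Connected) {a b : V} {t : ℕ} (ht : t ≤ G.dist a b) :
    ∃ z, G.dist a z = t ∧ t + G.dist z b = G.dist a b := by
  obtain ⟨p, hp⟩ := hG.exists_walk_length_eq_dist a b
  obtain ⟨z, q, r, hq, rfl⟩ := p.exists_append_eq_of_le_length (hp ▸ ht)
  rw [Walk.length_append] at hp
  have h1 := dist_le q
  have h2 := dist_le r
  have h3 := hG.dist_triangle (u := a) (v := z) (w := b)
  exact ⟨z, by omega, by omega⟩

theorem Connected.exists_trimmed_geodesic (hG : G.Connected) {a b : V} {t t' : ℕ}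
    (h : t + t' ≤ G.dist a b) :
    ∃ (p q : V) (w : G.Walk p q), (G.dist a p = t ∧ t + G.dist p b = G.dist a b) ∧
      (G.dist b q = t' ∧ t' + G.dist q a = G.dist b a) ∧ w.length + t + t' = G.dist a b ∧
        ∀ z ∈ w.support, G.dist a z + G.dist z b = G.dist a b := by
  obtain ⟨p, hp, hp'⟩ := hG.exists_dist_eq (a := a) (b := b) (t := t) (by omega)
  obtain ⟨q, hq, hq'⟩ := hG.exists_dist_eq (a := p) (b := b) (t := G.dist p b - t') (by omega)
  obtain ⟨w, hw, hgeo⟩ := hG.exists_geodesic p q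
  have t1 := hG.dist_triangle (u := a) (v := p) (w := q)
  have t2 := hG.dist_triangle (u := a) (v := q) (w := b)
  have c1 := G.dist_comm (u := a) (v := q)
  have c2 := G.dist_comm (u := b) (v := q)
  have c3 := G.dist_comm (u := a) (v := b)
  refine ⟨p, q, w, ⟨hp, hp'⟩, ⟨by omega, by omega⟩, by omega, fun z hz => ?_⟩
  have hz := hgeo z hz
  have t3 := hG.dist_triangle (u := a) (v := p) (w := z)
  have t4 := hG.dist_triangle (u := z) (v := q) (w := b)
  have t5 := hG.dist_triangle (u := a) (v := z) (w := b)
  omega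

/-- Two sides of a geodesic triangle at `u`, cut off at distance `t` from `u`, are joined by a
short path staying within the Gromov product `(x | y)_u` of `u`. -/
theorem FourPointBound.exists_corner_walk (hG : G.Connected) {P D t : ℕ}
    (hP : G.FourPointBound P D) {u x y u₁ u₂ : V}
    (hper : G.dist u x + G.dist x y + G.dist u y ≤ P)
    (ht : t = 0 ∨ 2 * t + D + G.dist x y ≤ G.dist u x + G.dist u y)
    (h₁ : G.dist u u₁ = t) (h₁' : t + G.dist u₁ x = G.dist u x)
    (h₂ : G.dist u u₂ = t) (h₂' : t + G.dist u₂ y = G.dist u y) :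
    ∃ p : G.Walk u₁ u₂, p.length ≤ 2 * D ∧
      ∀ z ∈ p.support, 2 * G.dist u z + G.dist x y ≤ G.dist u x + G.dist u y := by
  rcases ht with rfl | ht
  · obtain rfl := hG.dist_eq_zero_iff.1 h₁
    obtain rfl := hG.dist_eq_zero_iff.1 h₂
    refine ⟨.nil, by simp, fun z hz => ?_⟩
    obtain rfl : z = u := by simpa using hz
    have h := hG.dist_triangle (u := x) (v := z) (w := y)
    rw [G.dist_comm (u := x) (v := z)] at h
    rw [dist_self]
    omega
  · obtain ⟨p, hp, hgeo⟩ := hG.exists_geodesic u₁ u₂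
    have c1 := G.dist_comm (u := u) (v := u₁)
    have c2 := G.dist_comm (u := u) (v := u₂)
    have c3 := G.dist_comm (u := u) (v := y)
    have c4 := G.dist_comm (u := x) (v := u₁)
    have c5 := G.dist_comm (u := y) (v := u₁)
    have c6 := G.dist_comm (u := y) (v := u₂)
    have t1 := hG.dist_triangle (u := u₁) (v := x) (w := y)
    have t2 := hG.dist_triangle (u := u₁) (v := y) (w := u₂)
    -- `b1` gives `d(u₁,y) ≤ d(u,y) - t + D`, and then `b2` gives `d(u₁,u₂) ≤ 2D`.
    have b1 := hP u x u₁ y (by omega)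
    have b2 := hP u y u₁ u₂ (by omega)
    refine ⟨p, by omega, fun z hz => ?_⟩
    have hz := hgeo z hz
    have c7 := G.dist_comm (u := z) (v := u₁)
    have c8 := G.dist_comm (u := z) (v := u₂)
    have t3 := hG.dist_triangle (u := u) (v := u₁) (w := z)
    have t4 := hG.dist_triangle (u := u) (v := u₂) (w := z)
    -- With `m` the distance from `z` to the nearer of `u₁`, `u₂`, this gives `d(u,z) ≤ t + D - m`.
    -- Adding the triangle bound `d(u,z) ≤ t + m` yields `2d(u,z) ≤ 2t + D`.
    have b3 := hP u z u₁ u₂ (by omega)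
    omega

/-! ### Area of quadrilaterals with corners cut off. -/

/-- A truncated distance function separating two sets of vertices. -/
theorem Connected.exists_isEdgeLipschitz_separating (hG : G.Connected) {S T : Set V}
    (hS : S.Nonempty) {r : ℝ} (hr : 0 ≤ r) (h : ∀ z ∈ S, ∀ w ∈ T, r ≤ G.dist z w) :
    ∃ f : V → ℝ, G.IsEdgeLipschitz f ∧ (∀ z ∈ S, f z = 0) ∧ ∀ w ∈ T, f w = r := by
  set k : V → ℕ := fun w => sInf ((fun z => G.dist z w) '' S) with hk
  have hmem : ∀ w, ∃ z ∈ S, G.dist z w = k w := fun w => Nat.sInf_mem (hS.image _)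
  have hle : ∀ z ∈ S, ∀ w, k w ≤ G.dist z w := fun z hz w => Nat.sInf_le ⟨z, hz, rfl⟩
  have hstep : ∀ x y, G.Adj x y → (k x : ℝ) ≤ k y + 1 := fun x y hxy => by
    obtain ⟨z, hz, hzy⟩ := hmem y
    have h1 := hle z hz x
    have h2 := hG.dist_triangle (u := z) (v := y) (w := x)
    rw [dist_eq_one_iff_adj.2 hxy.symm] at h2
    exact_mod_cast h1.trans (hzy ▸ h2)
  refine ⟨fun w => min r (k w), fun x y hxy => ?_, fun z hz => ?_, fun w hw => ?_⟩
  · refine (abs_min_sub_min_le_max _ _ _ _).trans ?_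
    have h1 := hstep x y hxy
    have h2 := hstep y x hxy.symm
    rw [sub_self, abs_zero]
    exact max_le zero_le_one (abs_le.2 ⟨by linarith, by linarith⟩)
  · have : k z = 0 := Nat.le_zero.1 ((hle z hz z).trans_eq dist_self)
    simp [this, hr]
  · obtain ⟨z, hz, hzw⟩ := hmem w
    exact min_eq_left (hzw ▸ h z hz w hw)

/-- Area bound for a quadrilateral whose opposite sides are at distance at least `a`,
respectively at least `b`. -/
theorem HasLinearArea.mul_le (hG : G.Connected) {κ a b : ℝ} (hκ : G.HasLinearArea κ)
    (ha : 0 ≤ a) (hb : 0 ≤ b) {p q r t : V} (bottom : G.Walk p q) (right : G.Walk q r)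
    (top : G.Walk r t) (left : G.Walk t p)
    (hlr : ∀ z ∈ left.support, ∀ w ∈ right.support, a ≤ G.dist z w)
    (hbt : ∀ z ∈ bottom.support, ∀ w ∈ top.support, b ≤ G.dist z w) :
    a * b ≤ κ * (bottom.length + right.length + top.length + left.length) := by
  obtain ⟨ξ, hξ, hξ0, hξa⟩ := hG.exists_isEdgeLipschitz_separating
    (S := {z | z ∈ left.support}) (T := {z | z ∈ right.support}) ⟨t, by simp⟩ ha hlr
  obtain ⟨η, hη, hη0, hηb⟩ := hG.exists_isEdgeLipschitz_separating
    (S := {z | z ∈ bottom.support}) (T := {z | z ∈ top.support}) ⟨p, by simp⟩ hb hbt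
  have h := hκ η ξ hη hξ p (bottom.append (right.append (top.append left)))
  simp only [Walk.integral_append, Walk.length_append] at h
  -- Only `top` contributes to `∫ η dξ`: there `η = b` and `ξ` drops from `a` to `0`.
  rw [bottom.integral_eq_of_left_const hη0, right.integral_eq_zero_of_right_const hξa,
    top.integral_eq_of_left_const hηb, left.integral_eq_zero_of_right_const hξ0,
    hξ0 t (by simp), hξa r (by simp)] at h
  push_cast at h
  rw [abs_le] at h
  linarith

/-- Lower bound for the distance between the sides `[y, u]` and `[x, v]` of a quadrilateral, each
extended by the points within the Gromov products at its ends. -/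
theorem Connected.le_two_mul_dist (hG : G.Connected) {u v x y z w : V} {e : ℕ}
    (h21 : G.dist u x + G.dist v y ≤ G.dist u v + G.dist x y)
    (he : G.dist u y + G.dist x v + e = G.dist u v + G.dist x y)
    (hz : G.dist y z + G.dist z u = G.dist y u ∨
      2 * G.dist y z + G.dist u v ≤ G.dist y u + G.dist y v ∨
      2 * G.dist u z + G.dist y x ≤ G.dist u y + G.dist u x)
    (hw : G.dist x w + G.dist w v = G.dist x v ∨
      2 * G.dist x w + G.dist u v ≤ G.dist x u + G.dist x v ∨
      2 * G.dist v w + G.dist x y ≤ G.dist v x + G.dist v y) :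
    e ≤ 2 * G.dist z w := by
  have d1 := hG.dist_triangle (u := u) (v := z) (w := w)
  have d2 := hG.dist_triangle (u := u) (v := w) (w := v)
  have d3 := hG.dist_triangle (u := u) (v := w) (w := x)
  have d4 := hG.dist_triangle (u := y) (v := z) (w := w)
  have d5 := hG.dist_triangle (u := y) (v := w) (w := v)
  have d6 := hG.dist_triangle (u := y) (v := w) (w := x)
  rw [G.dist_comm (u := w) (v := x)] at d3 d6
  rw [G.dist_comm (u := w) (v := v)] at d2 d5 hw
  rw [G.dist_comm (u := z) (v := u), G.dist_comm (u := y) (v := u), G.dist_comm (u := y) (v := v),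
    G.dist_comm (u := y) (v := x)] at hz
  rw [G.dist_comm (u := y) (v := x)] at d6
  rw [G.dist_comm (u := y) (v := v)] at d5
  rw [G.dist_comm (u := x) (v := u), G.dist_comm (u := v) (v := x)] at hw
  generalize G.dist z w = r at *
  -- If both points lie on the sides, the routes `u-z-w-v` and `y-z-w-x` bound the largest sum. Near
  -- a corner, the Gromov product bound replaces the missing geodesic equality.
  rcases hz with hz | hz | hz <;> rcases hw with hw | hw | hw <;> lia

/-- A natural number `t` close to half of `a + b - c - D`. -/
theorem exists_corner_depth (D : ℕ) {a b c : ℕ} (h : c ≤ a + b) :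
    ∃ t, (t = 0 ∨ 2 * t + D + c ≤ a + b) ∧ 2 * t + c ≤ a + b ∧ a + b ≤ 2 * t + D + c + 1 :=
  ⟨(a + b - (c + D)) / 2, by omega, by omega, by omega⟩

theorem FourPointBound.area_le (hG : G.Connected) {P D : ℕ} (hP : G.FourPointBound P D) {κ : ℝ}
    (hκ0 : 0 ≤ κ) (hκ : G.HasLinearArea κ) {u v x y : V}
    (hper : G.dist u x + G.dist x v + G.dist v y + G.dist y u ≤ P)
    (h32 : G.dist u y + G.dist x v ≤ G.dist u x + G.dist v y)
    (h21 : G.dist u x + G.dist v y + D = G.dist u v + G.dist x y) {e : ℕ}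
    (he : G.dist u y + G.dist x v + e = G.dist u v + G.dist x y) :
    (e : ℝ) / 2 * (D / 2) ≤ κ * (e + 13 * D + 4) := by
  have c1 := G.dist_comm (u := u) (v := x)
  have c2 := G.dist_comm (u := u) (v := y)
  have c3 := G.dist_comm (u := v) (v := x)
  have c4 := G.dist_comm (u := v) (v := y)
  have c5 := G.dist_comm (u := u) (v := v)
  have c6 := G.dist_comm (u := x) (v := y)
  have t1 := hG.dist_triangle (u := x) (v := u) (w := y)
  have t2 := hG.dist_triangle (u := x) (v := v) (w := y)
  have t3 := hG.dist_triangle (u := u) (v := x) (w := v)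
  have t4 := hG.dist_triangle (u := u) (v := y) (w := v)
  obtain ⟨tu, au, lu, bu⟩ := exists_corner_depth D t1
  obtain ⟨tx, ax, lx, bx⟩ := exists_corner_depth D t3
  obtain ⟨tv, av, lv, bv⟩ := exists_corner_depth D t2
  obtain ⟨ty, ay, ly, b_y⟩ := exists_corner_depth D t4
  obtain ⟨u₁, x₁, bottom, hu₁, hx₁, hbottom, hbottom'⟩ :=
    hG.exists_trimmed_geodesic (a := u) (b := x) (t := tu) (t' := tx)
      (by linarith only [lu, lx, h32, h21, c1, c2, c3, c4])
  obtain ⟨x₂, v₁, right, hx₂, hv₁, hright, hright'⟩ :=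
    hG.exists_trimmed_geodesic (a := x) (b := v) (t := tx) (t' := tv)
      (by linarith only [lx, lv, h32, h21, c1, c2, c3, c4])
  obtain ⟨v₂, y₁, top, hv₂, hy₁, htop, htop'⟩ :=
    hG.exists_trimmed_geodesic (a := v) (b := y) (t := tv) (t' := ty)
      (by linarith only [lv, ly, h32, h21, c1, c2, c3, c4])
  obtain ⟨y₂, u₂, left, hy₂, hu₂, hleft, hleft'⟩ :=
    hG.exists_trimmed_geodesic (a := y) (b := u) (t := ty) (t' := tu)
      (by linarith only [ly, lu, h32, h21, c1, c2, c3, c4])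
  obtain ⟨cu, hcu, hcu'⟩ := hP.exists_corner_walk hG (t := tu)
    (by linarith only [hper, t2, c1, c2, c3, c4, c5, c6])
    (au.imp_right fun h => by linarith only [h, c1, c2, c3, c4, c5, c6])
    hu₂.1 hu₂.2 hu₁.1 hu₁.2
  obtain ⟨cx, hcx, hcx'⟩ := hP.exists_corner_walk hG (t := tx)
    (by linarith only [hper, t4, c1, c2, c3, c4, c5, c6])
    (ax.imp_right fun h => by linarith only [h, c1, c2, c3, c4, c5, c6])
    hx₁.1 hx₁.2 hx₂.1 hx₂.2
  obtain ⟨cv, hcv, hcv'⟩ := hP.exists_corner_walk hG (t := tv)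
    (by linarith only [hper, t1, c1, c2, c3, c4, c5, c6])
    (av.imp_right fun h => by linarith only [h, c1, c2, c3, c4, c5, c6])
    hv₁.1 hv₁.2 hv₂.1 hv₂.2
  obtain ⟨cy, hcy, hcy'⟩ := hP.exists_corner_walk hG (t := ty)
    (by linarith only [hper, t3, c1, c2, c3, c4, c5, c6])
    (ay.imp_right fun h => by linarith only [h, c1, c2, c3, c4, c5, c6])
    hy₁.1 hy₁.2 hy₂.1 hy₂.2
  have key := hκ.mul_le hG (a := e / 2) (b := D / 2) (by positivity) (by positivity)
    bottom (cx.append (right.append cv)) top (cy.append (left.append cu)) ?_ ?_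
  -- The trimmed sides total at most `e + 5D + 4`, the `4` coming from rounding the four depths; the
  -- corner walks add `8D`.
  · refine key.trans (mul_le_mul_of_nonneg_left ?_ hκ0)
    simp only [Walk.length_append]
    norm_cast
    linarith only [hcu, hcx, hcv, hcy, hbottom, hright, htop, hleft, bu, bx, bv, b_y, h21, he, c1,
      c2, c3, c4]
  · intro z hz w hw
    have hz : G.dist y z + G.dist z u = G.dist y u ∨
        2 * G.dist y z + G.dist u v ≤ G.dist y u + G.dist y v ∨
        2 * G.dist u z + G.dist y x ≤ G.dist u y + G.dist u x := by
      simp only [Walk.mem_support_append_iff] at hz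
      rcases hz with hz | hz | hz
      · exact .inr (.inl (by rw [c5, add_comm (G.dist y u)]; exact hcy' z hz))
      · exact .inl (hleft' z hz)
      · exact .inr (.inr (hcu' z hz))
    have hw : G.dist x w + G.dist w v = G.dist x v ∨
        2 * G.dist x w + G.dist u v ≤ G.dist x u + G.dist x v ∨
        2 * G.dist v w + G.dist x y ≤ G.dist v x + G.dist v y := by
      simp only [Walk.mem_support_append_iff] at hw
      rcases hw with hw | hw | hw
      exacts [.inr (.inl (hcx' w hw)), .inl (hright' w hw), .inr (.inr (hcv' w hw))]
    have h : e ≤ 2 * G.dist z w := hG.le_two_mul_dist (by linarith only [h21]) he hz hw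
    have : (e : ℝ) ≤ 2 * G.dist z w := by exact_mod_cast h
    linarith
  · intro z hz w hw
    suffices h : D ≤ 2 * G.dist z w by
      have : (D : ℝ) ≤ 2 * G.dist z w := by exact_mod_cast h
      linarith
    have h₁ := hG.dist_triangle (u := u) (v := z) (w := w)
    have h₂ := hG.dist_triangle (u := u) (v := w) (w := v)
    have h₃ := hG.dist_triangle (u := x) (v := z) (w := w)
    have h₄ := hG.dist_triangle (u := x) (v := w) (w := y)
    rw [G.dist_comm (u := x) (v := z)] at h₃
    rw [G.dist_comm (u := w) (v := v)] at h₂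
    linarith only [hbottom' z hz, htop' w hw, h₁, h₂, h₃, h₄, h21]

/-! ### Descent of the defect, and the final constants. -/

/-- A linear isoperimetric inequality bounds the defect in the four-point inequality. -/
theorem HasLinearArea.le_add (hG : G.Connected) {κ : ℝ} (hκ0 : 1 ≤ κ) (hκ : G.HasLinearArea κ)
    {P D : ℕ} (hP : G.FourPointBound P D) {u v x y : V}
    (hper : G.dist u x + G.dist x v + G.dist v y + G.dist y u ≤ P) :
    (G.dist u v + G.dist x y : ℝ) ≤
      max (G.dist u x + G.dist v y : ℝ) (G.dist u y + G.dist x v) + 64 * κ := by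
  induction D with
  | zero =>
    have h : (G.dist u v + G.dist x y : ℝ) ≤
        max (G.dist u x + G.dist v y : ℝ) (G.dist u y + G.dist x v) := by
      exact_mod_cast hP u v x y hper
    linarith
  | succ D ih =>
    by_cases hD : ((D + 1 : ℕ) : ℝ) ≤ 64 * κ
    · have h : (G.dist u v + G.dist x y : ℝ) ≤
          max (G.dist u x + G.dist v y : ℝ) (G.dist u y + G.dist x v) + (D + 1 : ℕ) := by
        exact_mod_cast hP u v x y hper
      linarith
    · refine ih fun u v x y hper => ?_
      by_contra hlt
      push Not at hD hlt
      have h := hP u v x y hper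
      -- With `d = D + 1 > 64κ` and `e ≥ d`, the left side is at least `16κe` and the right at most
      -- `15κe`.
      have small : ∀ e : ℕ, D + 1 ≤ e →
          ¬ (e : ℝ) / 2 * ((D + 1 : ℕ) / 2) ≤ κ * (e + 13 * (D + 1 : ℕ) + 4) := by
        intro e he hle
        have he : ((D + 1 : ℕ) : ℝ) ≤ e := by exact_mod_cast he
        generalize ((D + 1 : ℕ) : ℝ) = d at *
        have h1 : (e : ℝ) * (64 * κ) ≤ e * d := by gcongr
        have h2 : κ * (e + 13 * d + 4) ≤ κ * (15 * e) := by gcongr; linarith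
        have h3 : 0 < κ * e := by nlinarith
        linarith
      have c1 := G.dist_comm (u := u) (v := x)
      have c2 := G.dist_comm (u := u) (v := y)
      have c3 := G.dist_comm (u := v) (v := x)
      have c4 := G.dist_comm (u := v) (v := y)
      have c6 := G.dist_comm (u := x) (v := y)
      rcases le_total (G.dist u y + G.dist x v) (G.dist u x + G.dist v y) with hle | hle
      · refine small (G.dist u v + G.dist x y - (G.dist u y + G.dist x v)) (by omega) ?_
        exact hP.area_le hG (by linarith) hκ hper hle (by omega) (by omega)
      -- Exchanging `x` and `y` restores the order of the two smaller sums.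
      · refine small (G.dist u v + G.dist x y - (G.dist u x + G.dist y v)) (by omega) ?_
        exact hP.area_le hG (u := u) (v := v) (x := y) (y := x) (by linarith) hκ (by omega)
          (by omega) (by omega) (by omega)

end SimpleGraph

theorem theorem3p1 {V : Type*} (G : SimpleGraph V) (hG : G.Connected) (s s' : ℕ)
    (hs' : 0 < s') (hss' : s' < s) (hdis : IsStarDismantlable G s s') :
    IsHyperbolicGraph G
        (16 * ((s : ℝ) + (s' : ℝ)) * (⌈((s : ℝ) + (s' : ℝ)) / ((s : ℝ) - (s' : ℝ))⌉ : ℝ) + 1 / 2) ∧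
      16 * ((s : ℝ) + (s' : ℝ)) * (⌈((s : ℝ) + (s' : ℝ)) / ((s : ℝ) - (s' : ℝ))⌉ : ℝ) + 1 / 2 ≤
        32 * ((s : ℝ) * ((s : ℝ) + (s' : ℝ)) / ((s : ℝ) - (s' : ℝ))) + 1 / 2 := by
  have hs'R : (1 : ℝ) ≤ s' := by exact_mod_cast hs'
  have hd : (0 : ℝ) < (s : ℝ) - s' := by rw [sub_pos]; exact_mod_cast hss'
  constructor
  · intro u v x y _ h
    have hκ := SimpleGraph.hasLinearArea_of_isStarDismantlable hG hss' hdis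
    have hκ1 : 1 ≤ ((s : ℝ) + s') ^ 2 / (2 * ((s : ℝ) - s')) := by
      rw [le_div_iff₀ (by positivity)]
      nlinarith
    have h4 := hκ.le_add hG hκ1 (hG.fourPointBound_self _) (le_refl
      (G.dist u x + G.dist x v + G.dist v y + G.dist y u))
    rw [max_eq_left (by rw [G.dist_comm (u := x) (v := v)]; exact_mod_cast ‹_›)] at h4
    have hceil : ((s : ℝ) + s') * (((s : ℝ) + s') / ((s : ℝ) - s')) ≤
        ((s : ℝ) + s') * ⌈((s : ℝ) + s') / ((s : ℝ) - s')⌉ := by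
      gcongr
      exact Int.le_ceil _
    have hval : 64 * (((s : ℝ) + s') ^ 2 / (2 * ((s : ℝ) - s'))) =
        32 * (((s : ℝ) + s') * (((s : ℝ) + s') / ((s : ℝ) - s'))) := by
      field_simp
      norm_num
    linarith
  -- `(s+s')/(s-s') + 1 = 2s/(s-s')`.
  · have hceil : (⌈((s : ℝ) + s') / ((s : ℝ) - s')⌉ : ℝ) ≤ 2 * (s / ((s : ℝ) - s')) := by
      refine (Int.ceil_lt_add_one _).le.trans_eq ?_
      field_simp
      ring
    have := mul_le_mul_of_nonneg_left hceil (show 0 ≤ 16 * ((s : ℝ) + s') by positivity)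
    calc _ ≤ 16 * ((s : ℝ) + s') * (2 * (s / ((s : ℝ) - s'))) + 1 / 2 := by gcongr
      _ = _ := by ring
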